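/- For a topological space $X$, let $d(X)$ and $w(X)$ be the density and the weight of $X$ (the least cardinality of a dense subset, respectively of a base, finite values being replaced by $\aleph_0$). Call $X$ \emph{zero-dimensional} if its clopen subsets form a base, and \emph{selectively highly divergent} (SHD) if for every sequence $(U_n)_{n\in\omega}$ of non-empty open subsets of $X$ there are points $x_n\in U_n$ such that the sequence $(x_n)_{n\in\omega}$ has no convergent subsequence. Let $\mathsf{R}(X)$ be the Boolean algebra of regular closed subsets of $X$ (the sets $A$ with $A=\operatorname{cl}\operatorname{int}A$, ordered by inclusion), and let $\theta X$ be the set of all ultrafilters of $\mathsf{R}(X)$ with the topology that has the sets $\{\mathscr{U}\in\theta X : A\in\mathscr{U}\}$, $A\in\mathsf{R}(X)$, as a base. \textbf{Theorem.} Let $\kappa$ be an infinite cardinal and $\lambda=2^{\kappa}$. Let $\lambda^{*}=\beta D\setminus D$ be the remainder of the Stone--Čech compactification of the discrete space $D$ of cardinality $\lambda$. Then $Y_\kappa=\theta(\lambda^{*})$ is a compact Hausdorff, zero-dimensional SHD space, and $$d(Y_\kappa)=2^{\kappa}\le w(Y_\kappa)\le 2^{2^{\kappa}}.$$ -/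

import Mathlib

open Set Filter Topology Cardinal

universe u

namespace SHDSpace



/-- A space is selectively highly divergent (SHD) if in every sequence of non-empty open sets one
can choose points forming a sequence without convergent subsequences. -/
def IsSHD (X : Type u) [TopologicalSpace X] : Prop :=
  ∀ U : ℕ → Set X, (∀ n, IsOpen (U n) ∧ (U n).Nonempty) →
    ∃ x : ℕ → X, (∀ n, x n ∈ U n) ∧
      ∀ φ : ℕ → ℕ, StrictMono φ → ¬ ∃ p : X, Tendsto (x ∘ φ) atTop (𝓝 p)

/-- The clopen subsets form a base of the topology. -/
def IsZeroDimensional (X : Type u) [TopologicalSpace X] : Prop :=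
  TopologicalSpace.IsTopologicalBasis {s : Set X | IsClopen s}

/-- The density `d(X)`: the least cardinality of a dense subset. As usual for cardinal functions in
topology, finite values are replaced by `ℵ₀`. -/
noncomputable def density (X : Type u) [TopologicalSpace X] : Cardinal.{u} :=
  max ℵ₀ (sInf {c : Cardinal.{u} | ∃ S : Set X, Dense S ∧ #S = c})

/-- The weight `w(X)`: the least cardinality of a base. As usual for cardinal functions in
topology, finite values are replaced by `ℵ₀`. -/
noncomputable def weight (X : Type u) [TopologicalSpace X] : Cardinal.{u} :=
  max ℵ₀ (sInf {c : Cardinal.{u} |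
    ∃ B : Set (Set X), TopologicalSpace.IsTopologicalBasis B ∧ #B = c})

/-- The remainder `X^* = βX \ X` of the Stone–Čech compactification, as a subspace of `βX`. -/
abbrev StoneCechRemainder (X : Type u) [TopologicalSpace X] : Type u :=
  {p : StoneCech X // p ∉ range (stoneCechUnit : X → StoneCech X)}

/-- Regular closed sets. Ordered by inclusion they form the Boolean algebra `R(X)`, where the
least element is `∅`, the greatest is `X`, and the meet of `A` and `B` is `cl (int (A ∩ B))`. -/
def IsRegularClosed {X : Type u} [TopologicalSpace X] (A : Set X) : Prop :=
  closure (interior A) = A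

/-- Proper filters of the Boolean algebra `R(X)` of regular closed sets. -/
structure IsRegularClosedFilter {X : Type u} [TopologicalSpace X] (F : Set (Set X)) : Prop where
  isRegularClosed : ∀ A ∈ F, IsRegularClosed A
  univ_mem : Set.univ ∈ F
  empty_notMem : ∅ ∉ F
  inf_mem : ∀ A ∈ F, ∀ B ∈ F, closure (interior (A ∩ B)) ∈ F
  mem_of_subset : ∀ A ∈ F, ∀ B, IsRegularClosed B → A ⊆ B → B ∈ F

/-- `θX`: the set of `R(X)`-ultrafilters, i.e. of the maximal proper filters of `R(X)`. -/
def Theta (X : Type u) [TopologicalSpace X] : Type u :=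
  {F : Set (Set X) // Maximal IsRegularClosedFilter F}

/-- `λ(A)`: the set of the `R(X)`-ultrafilters that contain `A`. -/
def Theta.basic {X : Type u} [TopologicalSpace X] (A : Set X) : Set (Theta X) :=
  {F | A ∈ F.1}

/-- The topology of `θX`, with base the sets `λ(A)` for `A` regular closed. -/
instance Theta.instTopologicalSpace (X : Type u) [TopologicalSpace X] :
    TopologicalSpace (Theta X) :=
  TopologicalSpace.generateFrom {V | ∃ A : Set X, IsRegularClosed A ∧ V = Theta.basic A}

/-- The sets `λ(A)` are indeed a base, not merely a subbase. -/
theorem Theta.isTopologicalBasis_basic (X : Type u) [TopologicalSpace X] :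
    TopologicalSpace.IsTopologicalBasis
      {V : Set (Theta X) | ∃ A : Set X, IsRegularClosed A ∧ V = Theta.basic A} := by
  have hreg : ∀ S : Set X, IsClosed S → IsRegularClosed (closure (interior S)) := fun S _ =>
    subset_antisymm (closure_minimal interior_subset isClosed_closure)
      (closure_mono (interior_maximal subset_closure isOpen_interior))
  have hcl : ∀ S : Set X, IsRegularClosed S → IsClosed S := fun S h => by
    rw [← h]; exact isClosed_closure
  refine ⟨?_, ?_, rfl⟩
  · rintro _ ⟨A, hA, rfl⟩ _ ⟨B, hB, rfl⟩ F ⟨hFA, hFB⟩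
    have hAB : IsClosed (A ∩ B) := (hcl A hA).inter (hcl B hB)
    have hsub : closure (interior (A ∩ B)) ⊆ A ∩ B := closure_minimal interior_subset hAB
    refine ⟨_, ⟨closure (interior (A ∩ B)), hreg _ hAB, rfl⟩,
      F.2.prop.inf_mem A hFA B hFB, fun G hG => ⟨?_, ?_⟩⟩
    · exact G.2.prop.mem_of_subset _ hG A hA (hsub.trans inter_subset_left)
    · exact G.2.prop.mem_of_subset _ hG B hB (hsub.trans inter_subset_right)
  · refine eq_univ_of_forall fun F => ?_
    exact ⟨_, ⟨Set.univ, by simp [IsRegularClosed], rfl⟩, F.2.prop.univ_mem⟩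

end SHDSpace

/-! The space `Theta X` is the Stone space of the complete Boolean algebra of regular closed sets,
hence compact, Hausdorff, zero-dimensional and, by completeness, extremally disconnected
(`exists_isClopen_separating`). In such a space no injective sequence converges
(`not_tendsto_of_injective`), so SHD only requires choosing distinct points, which is possible once
all non-empty open sets are infinite.

For the remainder of a discrete `D`, every non-empty open set of the Theta space contains `basic
(star (range f))` for some `f : ℕ → D` of infinite range. This rules out isolated points and bounds
the density by `#(ℕ → D)` and the weight by its power set. Splitting `D` into `#D` infinite pieces
gives disjoint open sets, hence the lower bounds. For `#D = 2 ^ κ`, `#(ℕ → D) = #D`. -/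

namespace SHDSpace

/-! ### Regular closed sets and their ultrafilters -/

section RegularClosed

variable {X : Type u} [TopologicalSpace X]

theorem IsRegularClosed.isClosed {A : Set X} (hA : IsRegularClosed A) : IsClosed A := by
  rw [← hA]; exact isClosed_closure

theorem isRegularClosed_closure {U : Set X} (hU : IsOpen U) :
    IsRegularClosed (closure U) :=
  subset_antisymm (closure_minimal interior_subset isClosed_closure)
    (closure_mono (interior_maximal subset_closure hU))

theorem IsRegularClosed.closure_compl {A : Set X} (hA : IsRegularClosed A) :
    IsRegularClosed (closure Aᶜ) :=
  isRegularClosed_closure hA.isClosed.isOpen_compl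

theorem interior_inter_closure_compl (A : Set X) : interior (A ∩ closure Aᶜ) = ∅ := by
  rw [closure_compl, interior_inter, ← disjoint_iff_inter_eq_empty]
  exact disjoint_compl_right.mono_right interior_subset

theorem closure_interior_inter_subset {A B : Set X} (hA : IsRegularClosed A)
    (hB : IsRegularClosed B) : closure (interior (A ∩ B)) ⊆ A ∩ B :=
  closure_minimal interior_subset (hA.isClosed.inter hB.isClosed)

theorem subset_closure_compl {A B : Set X} (hB : IsRegularClosed B)
    (h : interior (A ∩ B) = ∅) : B ⊆ closure Aᶜ := by
  rw [closure_compl, ← hB]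
  refine closure_minimal (fun x hx hxA => ?_) isOpen_interior.isClosed_compl
  have : x ∈ interior (A ∩ B) := by rw [interior_inter]; exact ⟨hxA, hx⟩
  simp [h] at this

theorem IsRegularClosedFilter.maximal {F : Set (Set X)} (hF : IsRegularClosedFilter F)
    (h : ∀ A, IsRegularClosed A → A ∈ F ∨ closure Aᶜ ∈ F) : Maximal IsRegularClosedFilter F := by
  refine ⟨hF, fun G hG hFG A hA => ?_⟩
  refine (h A (hG.isRegularClosed A hA)).resolve_right fun hA' => hG.empty_notMem ?_
  simpa only [interior_inter_closure_compl, closure_empty] using hG.inf_mem A hA _ (hFG hA')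

/-- The filter generated by `F` and `A` is proper, so maximality makes it equal to `F`. -/
theorem mem_of_forall_interior_inter_nonempty {F : Set (Set X)}
    (hF : Maximal IsRegularClosedFilter F) {A : Set X} (hA : IsRegularClosed A)
    (h : ∀ B ∈ F, (interior (A ∩ B)).Nonempty) : A ∈ F := by
  let G : Set (Set X) := {C | IsRegularClosed C ∧ ∃ B ∈ F, interior (A ∩ B) ⊆ C}
  have hG : IsRegularClosedFilter G := by
    refine ⟨fun C hC => hC.1, ⟨by simp [IsRegularClosed], univ, hF.prop.univ_mem, subset_univ _⟩,
      ?_, ?_, ?_⟩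
    · rintro ⟨-, B, hB, hBe⟩
      exact (h B hB).ne_empty (subset_empty_iff.1 hBe)
    · rintro C ⟨hC, B, hB, hBC⟩ C' ⟨hC', B', hB', hBC'⟩
      refine ⟨isRegularClosed_closure isOpen_interior, _, hF.prop.inf_mem B hB B' hB', ?_⟩
      refine (interior_maximal (subset_inter (Subset.trans ?_ hBC) (Subset.trans ?_ hBC'))
        isOpen_interior).trans subset_closure
      · exact interior_mono (inter_subset_inter_right _ ((closure_interior_inter_subset
          (hF.prop.isRegularClosed B hB) (hF.prop.isRegularClosed B' hB')).trans
            inter_subset_left))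
      · exact interior_mono (inter_subset_inter_right _ ((closure_interior_inter_subset
          (hF.prop.isRegularClosed B hB) (hF.prop.isRegularClosed B' hB')).trans
            inter_subset_right))
    · rintro C ⟨-, B, hB, hBC⟩ C' hC' hCC'
      exact ⟨hC', B, hB, hBC.trans hCC'⟩
  have hFG : F ⊆ G := fun B hB =>
    ⟨hF.prop.isRegularClosed B hB, B, hB, interior_subset.trans inter_subset_right⟩
  exact hF.le_of_ge hG hFG ⟨hA, univ, hF.prop.univ_mem, interior_subset.trans inter_subset_left⟩

theorem mem_or_closure_compl_mem {F : Set (Set X)} (hF : Maximal IsRegularClosedFilter F)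
    {A : Set X} (hA : IsRegularClosed A) : A ∈ F ∨ closure Aᶜ ∈ F := by
  by_contra! hn
  refine hn.1 (mem_of_forall_interior_inter_nonempty hF hA fun B hB => ?_)
  by_contra hne
  exact hn.2 (hF.prop.mem_of_subset B hB _ hA.closure_compl
    (subset_closure_compl (hF.prop.isRegularClosed B hB) (not_nonempty_iff_eq_empty.1 hne)))

/-- The filter of the sets with dense interior. -/
def denseInteriorFilter (X : Type u) [TopologicalSpace X] : Filter X where
  sets := {s | Dense (interior s)}
  univ_sets := by simp
  sets_of_superset hs hst := hs.mono (interior_mono hst)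
  inter_sets hs ht := by
    simp only [mem_ofPred_eq, interior_inter]
    exact Dense.inter_of_isOpen_left hs ht isOpen_interior

theorem mem_denseInteriorFilter {s : Set X} :
    s ∈ denseInteriorFilter X ↔ Dense (interior s) := Iff.rfl

theorem compl_diff_interior_mem_denseInteriorFilter {A : Set X} (hA : IsClosed A) :
    (A \ interior A)ᶜ ∈ denseInteriorFilter X := by
  have h : interior (closure (A \ interior A)) = ∅ := by
    rw [← hA.frontier_eq, isClosed_frontier.closure_eq, interior_frontier hA]
  rw [mem_denseInteriorFilter, interior_compl, ← interior_eq_empty_iff_dense_compl]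
  exact h

/-- Take the regular closed members of an ultrafilter of points that contains all sets with dense
interior. It ignores boundaries of closed sets, so the meet `closure (interior (B ∩ C))` is as good
as `B ∩ C`. -/
theorem exists_maximal_filter_mem {A : Set X} (hA : IsRegularClosed A) (hne : A.Nonempty) :
    ∃ F, Maximal IsRegularClosedFilter F ∧ A ∈ F := by
  have hint : (interior A).Nonempty := by
    rw [← closure_nonempty_iff, hA]; exact hne
  have : (denseInteriorFilter X ⊓ 𝓟 (interior A)).NeBot := by
    rw [inf_principal_neBot_iff]
    intro s hs
    exact ((mem_denseInteriorFilter.1 hs).inter_open_nonempty _ isOpen_interior hint).mono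
      fun x hx => ⟨interior_subset hx.2, hx.1⟩
  let v := Ultrafilter.of (denseInteriorFilter X ⊓ 𝓟 (interior A))
  have hv : (v : Filter X) ≤ denseInteriorFilter X ⊓ 𝓟 (interior A) := Ultrafilter.of_le _
  refine ⟨{B | IsRegularClosed B ∧ B ∈ v}, IsRegularClosedFilter.maximal ⟨fun B hB => hB.1,
    ⟨by simp [IsRegularClosed], univ_mem⟩, fun h => v.empty_notMem h.2, ?_, ?_⟩ ?_, hA, ?_⟩
  · rintro B ⟨hB, hBv⟩ C ⟨hC, hCv⟩
    refine ⟨isRegularClosed_closure isOpen_interior, ?_⟩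
    have h := hv.trans inf_le_left
      (compl_diff_interior_mem_denseInteriorFilter (hB.isClosed.inter hC.isClosed))
    filter_upwards [hBv, hCv, h] with x hxB hxC hx
    by_contra hn
    exact hx ⟨⟨hxB, hxC⟩, fun hx' => hn (subset_closure hx')⟩
  · rintro B ⟨-, hBv⟩ C hC hBC
    exact ⟨hC, mem_of_superset hBv hBC⟩
  · intro B hB
    rcases v.mem_or_compl_mem B with h | h
    · exact Or.inl ⟨hB, h⟩
    · exact Or.inr ⟨hB.closure_compl, mem_of_superset h subset_closure⟩
  · exact mem_of_superset (hv.trans inf_le_right (mem_principal_self _)) interior_subset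

end RegularClosed

/-! ### The Stone space of the regular closed algebra -/

namespace Theta

variable {X : Type u} [TopologicalSpace X]

theorem isOpen_basic {A : Set X} (hA : IsRegularClosed A) : IsOpen (basic A) :=
  (isTopologicalBasis_basic X).isOpen ⟨A, hA, rfl⟩

theorem basic_nonempty {A : Set X} (hA : IsRegularClosed A) (hne : A.Nonempty) :
    (basic A).Nonempty :=
  let ⟨F, hF, hAF⟩ := exists_maximal_filter_mem hA hne
  ⟨⟨F, hF⟩, hAF⟩

theorem basic_inter {A B : Set X} (hA : IsRegularClosed A) (hB : IsRegularClosed B) :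
    basic A ∩ basic B = basic (closure (interior (A ∩ B))) := by
  refine subset_antisymm (fun F hF => F.2.prop.inf_mem A hF.1 B hF.2) fun F hF => ⟨?_, ?_⟩
  · exact F.2.prop.mem_of_subset _ hF A hA
      ((closure_interior_inter_subset hA hB).trans inter_subset_left)
  · exact F.2.prop.mem_of_subset _ hF B hB
      ((closure_interior_inter_subset hA hB).trans inter_subset_right)

theorem basic_mono {A B : Set X} (hB : IsRegularClosed B) (h : A ⊆ B) : basic A ⊆ basic B :=
  fun F hF => F.2.prop.mem_of_subset _ hF B hB h

theorem disjoint_basic_iff {A B : Set X} (hA : IsRegularClosed A) (hB : IsRegularClosed B) :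
    Disjoint (basic A) (basic B) ↔ interior (A ∩ B) = ∅ := by
  rw [disjoint_iff_inter_eq_empty, basic_inter hA hB]
  constructor
  · intro h
    by_contra hne
    exact (basic_nonempty (isRegularClosed_closure isOpen_interior)
      (closure_nonempty_iff.2 (nonempty_iff_ne_empty.2 hne))).ne_empty h
  · intro h
    rw [h, closure_empty]
    exact eq_empty_of_forall_notMem fun F hF => F.2.prop.empty_notMem hF

theorem compl_basic {A : Set X} (hA : IsRegularClosed A) : (basic A)ᶜ = basic (closure Aᶜ) := by
  refine subset_antisymm (fun F hF => (mem_or_closure_compl_mem F.2 hA).resolve_left hF) ?_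
  exact ((disjoint_basic_iff hA hA.closure_compl).2
    (interior_inter_closure_compl A)).subset_compl_left

theorem isClopen_basic {A : Set X} (hA : IsRegularClosed A) : IsClopen (basic A) :=
  ⟨by rw [← isOpen_compl_iff, compl_basic hA]; exact isOpen_basic hA.closure_compl,
    isOpen_basic hA⟩

theorem isZeroDimensional : IsZeroDimensional (Theta X) :=
  (isTopologicalBasis_basic X).of_isOpen_of_subset (fun _ h => h.isOpen) (by
    rintro _ ⟨A, hA, rfl⟩
    exact isClopen_basic hA)

instance t2Space : T2Space (Theta X) := by
  refine ⟨fun F G hFG => ?_⟩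
  obtain ⟨A, hAF, hAG⟩ : ∃ A ∈ F.1, A ∉ G.1 := by
    by_contra! h
    exact hFG (Subtype.ext (subset_antisymm h (F.2.le_of_ge G.2.prop h)))
  have hA := isClopen_basic (F.2.prop.isRegularClosed A hAF)
  exact ⟨basic A, (basic A)ᶜ, hA.isOpen, hA.compl.isOpen, hAF, hAG, disjoint_compl_right⟩

instance compactSpace : CompactSpace (Theta X) := by
  refine ⟨isCompact_iff_ultrafilter_le_nhds.2 fun v _ => ?_⟩
  let F : Set (Set X) := {A | IsRegularClosed A ∧ basic A ∈ v}
  have hF : Maximal IsRegularClosedFilter F := by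
    refine IsRegularClosedFilter.maximal ⟨fun A hA => hA.1, ⟨by simp [IsRegularClosed], ?_⟩,
      ?_, ?_, ?_⟩ ?_
    · exact mem_of_superset univ_mem fun G _ => G.2.prop.univ_mem
    · rintro ⟨-, h⟩
      obtain ⟨G, hG⟩ := v.nonempty_of_mem h
      exact G.2.prop.empty_notMem hG
    · rintro A ⟨hA, hAv⟩ B ⟨hB, hBv⟩
      exact ⟨isRegularClosed_closure isOpen_interior,
        basic_inter hA hB ▸ inter_mem hAv hBv⟩
    · rintro A ⟨-, hAv⟩ B hB hAB
      exact ⟨hB, mem_of_superset hAv (basic_mono hB hAB)⟩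
    · intro A hA
      rcases v.mem_or_compl_mem (basic A) with h | h
      · exact Or.inl ⟨hA, h⟩
      · exact Or.inr ⟨hA.closure_compl, compl_basic hA ▸ h⟩
  refine ⟨⟨F, hF⟩, mem_univ _, fun s hs => ?_⟩
  obtain ⟨_, ⟨A, hA, rfl⟩, hAF, hAs⟩ := (isTopologicalBasis_basic X).mem_nhds_iff.1 hs
  exact mem_of_superset hAF.2 hAs

/-- Completeness of the algebra: the supremum of all `A` with `basic A ⊆ V` is the closure of the
union of their interiors, and it still has meet zero with every `B` such that `basic B ⊆ W`. -/
theorem exists_isClopen_separating {V W : Set (Theta X)} (hV : IsOpen V) (hW : IsOpen W)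
    (hVW : Disjoint V W) : ∃ C : Set (Theta X), IsClopen C ∧ V ⊆ C ∧ Disjoint C W := by
  let O : Set X := ⋃₀ {U | ∃ A, IsRegularClosed A ∧ basic A ⊆ V ∧ U = interior A}
  have hO : IsOpen O := isOpen_sUnion (by rintro _ ⟨A, -, -, rfl⟩; exact isOpen_interior)
  have hC := isRegularClosed_closure hO
  refine ⟨basic (closure O), isClopen_basic hC, fun F hF => ?_, ?_⟩
  · obtain ⟨_, ⟨A, hA, rfl⟩, hAF, hAV⟩ := (isTopologicalBasis_basic X).exists_subset_of_mem_open
      hF hV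
    refine basic_mono hC ?_ hAF
    rw [← hA]
    exact closure_mono (subset_sUnion_of_mem ⟨A, hA, hAV, rfl⟩)
  · rw [disjoint_right]
    intro F hF
    obtain ⟨_, ⟨B, hB, rfl⟩, hBF, hBW⟩ := (isTopologicalBasis_basic X).exists_subset_of_mem_open
      hF hW
    refine disjoint_right.1 ((disjoint_basic_iff hC hB).2 ?_) hBF
    rw [interior_inter, ← disjoint_iff_inter_eq_empty]
    refine Disjoint.mono_left interior_subset (Disjoint.closure_left ?_ isOpen_interior)
    rw [disjoint_sUnion_left]
    rintro _ ⟨A, hA, hAV, rfl⟩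
    rw [disjoint_iff_inter_eq_empty, ← interior_inter]
    exact (disjoint_basic_iff hA hB).1 (hVW.mono hAV hBW)

end Theta

/-! ### Sequences of distinct points -/

theorem exists_injective_forall_mem_of_infinite {X : Type u} {U : ℕ → Set X}
    (hU : ∀ n, (U n).Infinite) : ∃ x : ℕ → X, Function.Injective x ∧ ∀ n, x n ∈ U n := by
  classical
  -- Size `n + 1` secures Hall's condition: a finite `s` has at most `max s + 1` indices, and `t
  -- (max s)` alone has that many points.
  choose t htU htc using fun n => (hU n).exists_subset_card_eq (n + 1)
  obtain ⟨x, hx, hxt⟩ := (Finset.all_card_le_biUnion_card_iff_exists_injective t).1 fun s => by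
    rcases s.eq_empty_or_nonempty with rfl | hs
    · simp
    calc s.card ≤ (Finset.range (s.max' hs + 1)).card := Finset.card_le_card fun i hi =>
          Finset.mem_range.2 (Nat.lt_succ_of_le (s.le_max' i hi))
      _ = (t (s.max' hs)).card := by rw [Finset.card_range, htc]
      _ ≤ (s.biUnion t).card :=
          Finset.card_le_card (Finset.subset_biUnion_of_mem t (s.max'_mem hs))
  exact ⟨x, hx, fun n => htU n (hxt n)⟩

/-- The points of a convergent sequence of distinct points, all different from the limit, have
pairwise disjoint open neighbourhoods, provided that the space is zero-dimensional. -/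
theorem exists_pairwise_disjoint_isOpen_of_tendsto {Y : Type u} [TopologicalSpace Y] [T2Space Y]
    (hY : IsZeroDimensional Y) {x : ℕ → Y} (hx : Function.Injective x) {p : Y}
    (hp : ∀ n, x n ≠ p) (hlim : Tendsto x atTop (𝓝 p)) :
    ∃ V : ℕ → Set Y, (∀ n, IsOpen (V n)) ∧ (∀ n, x n ∈ V n) ∧
      Pairwise fun m n => Disjoint (V m) (V n) := by
  have key : ∀ n, ∃ W : Set Y, IsClopen W ∧ x n ∈ W ∧ ∀ m, m ≠ n → x m ∉ W := fun n => by
    -- Overwriting `x n` by the limit keeps convergence, so all the other terms together with `p`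
    -- form a closed set missing `x n`.
    have hlim' : Tendsto (Function.update x n p) atTop (𝓝 p) := by
      refine hlim.congr' ?_
      filter_upwards [eventually_gt_atTop n] with m hm
      rw [Function.update_of_ne hm.ne']
    have hcl := hlim'.isCompact_insert_range.isClosed
    have hn : x n ∈ (insert p (range (Function.update x n p)))ᶜ := by
      rintro (h | ⟨m, hm⟩)
      · exact hp n h
      · by_cases hmn : m = n
        · subst hmn
          rw [Function.update_self] at hm
          exact hp _ hm.symm
        · rw [Function.update_of_ne hmn] at hm
          exact hmn (hx hm)
    obtain ⟨W, hW, hxW, hWs⟩ := hY.exists_subset_of_mem_open hn hcl.isOpen_compl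
    refine ⟨W, hW, hxW, fun m hmn hm => hWs hm (Or.inr ⟨m, ?_⟩)⟩
    rw [Function.update_of_ne hmn]
  choose W hW hxW hne using key
  refine ⟨disjointed W, fun n => ?_, fun n => ?_, disjoint_disjointed W⟩
  · exact disjointedRec (p := IsOpen) (fun _ i h => h.sdiff (hW i).isClosed) (hW n).isOpen
  · rw [disjointed_apply]
    refine ⟨hxW n, fun h => ?_⟩
    rw [Finset.sup_set_eq_biUnion] at h
    simp only [mem_iUnion, Finset.mem_Iio] at h
    obtain ⟨k, hk, hkn⟩ := h
    exact hne k n hk.ne' hkn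

namespace Theta

variable {X : Type u} [TopologicalSpace X]

/-- A clopen set separating neighbourhoods of the even terms from those of the odd terms would have
the limit both inside and outside it. -/
theorem not_tendsto_of_injective {x : ℕ → Theta X} (hx : Function.Injective x) (p : Theta X) :
    ¬ Tendsto x atTop (𝓝 p) := by
  intro hlim
  obtain ⟨N, hN⟩ : ∃ N, ∀ n, x (n + N) ≠ p := by
    by_cases h : ∃ m, x m = p
    · obtain ⟨m, rfl⟩ := h
      exact ⟨m + 1, fun n h => by have := hx h; omega⟩
    · push Not at h
      exact ⟨0, fun n => h _⟩
  have hlim' : Tendsto (fun n => x (n + N)) atTop (𝓝 p) := hlim.comp (tendsto_add_atTop_nat N)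
  obtain ⟨V, hVo, hxV, hV⟩ := exists_pairwise_disjoint_isOpen_of_tendsto isZeroDimensional
    (fun a b h => Nat.add_right_cancel (hx h)) hN hlim'
  obtain ⟨C, hC, hVC, hCW⟩ := exists_isClopen_separating
    (isOpen_iUnion fun n => hVo (2 * n)) (isOpen_iUnion fun n => hVo (2 * n + 1)) (by
      simp only [disjoint_iUnion_left, disjoint_iUnion_right]
      exact fun i j => hV (by omega))
  have h0 : Tendsto (fun n : ℕ => 2 * n) atTop atTop :=
    tendsto_atTop_mono (fun n => by simp only [id]; omega) tendsto_id
  have h1 : Tendsto (fun n : ℕ => 2 * n + 1) atTop atTop :=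
    tendsto_atTop_mono (fun n => by simp only [id]; omega) tendsto_id
  have hpC : p ∈ C := hC.isClosed.mem_of_tendsto (hlim'.comp h0)
    (Eventually.of_forall fun n => hVC (mem_iUnion.2 ⟨n, hxV _⟩))
  have hpC' : p ∈ Cᶜ := hC.compl.isClosed.mem_of_tendsto (hlim'.comp h1)
    (Eventually.of_forall fun n => hCW.subset_compl_left (mem_iUnion.2 ⟨n, hxV _⟩))
  exact hpC' hpC

theorem isSHD_of_infinite (h : ∀ U : Set (Theta X), IsOpen U → U.Nonempty → U.Infinite) :
    IsSHD (Theta X) := by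
  intro U hU
  obtain ⟨x, hx, hxU⟩ := exists_injective_forall_mem_of_infinite fun n =>
    h (U n) (hU n).1 (hU n).2
  exact ⟨x, hxU, fun φ hφ ⟨p, hp⟩ => not_tendsto_of_injective (hx.comp hφ.injective) p hp⟩

end Theta

/-- The Stone–Čech compactification of a discrete space is its space of ultrafilters. -/
noncomputable def stoneCechHomeomorphUltrafilter (D : Type u) [TopologicalSpace D]
    [DiscreteTopology D] : StoneCech D ≃ₜ Ultrafilter D where
  toFun := stoneCechExtend (g := (pure : D → Ultrafilter D)) continuous_of_discreteTopology
  invFun := Ultrafilter.extend stoneCechUnit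
  left_inv := congr_fun <| stoneCech_hom_ext
    ((continuous_ultrafilter_extend _).comp (continuous_stoneCechExtend _)) continuous_id (by
      ext a
      simp [stoneCechExtend_stoneCechUnit])
  right_inv := congr_fun <| denseRange_pure.equalizer
    ((continuous_stoneCechExtend _).comp (continuous_ultrafilter_extend _)) continuous_id (by
      ext1 a
      simp [stoneCechExtend_stoneCechUnit])
  continuous_toFun := continuous_stoneCechExtend _
  continuous_invFun := continuous_ultrafilter_extend _

theorem infinite_of_mem_of_ne_pure {D : Type u} {v : Ultrafilter D} {A : Set D} (hA : A ∈ v)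
    (hv : ∀ a, v ≠ pure a) : A.Infinite := fun hfin => by
  rcases v.le_cofinite_or_eq_pure with h | ⟨a, rfl⟩
  · exact v.compl_notMem_iff.2 hA (h hfin.compl_mem_cofinite)
  · exact hv a rfl

/-! ### The remainder of a discrete space -/

namespace StoneCechRemainder

variable {D : Type u} [TopologicalSpace D] [DiscreteTopology D]

/-- The trace on the remainder of the closure of a subset of a discrete space. -/
def star (A : Set D) : Set (StoneCechRemainder D) :=
  {p | A ∈ stoneCechHomeomorphUltrafilter D p.1}

theorem homeomorph_ne_pure (p : StoneCechRemainder D) (a : D) :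
    stoneCechHomeomorphUltrafilter D p.1 ≠ pure a := fun h => by
  refine p.2 ⟨a, ?_⟩
  rw [← Homeomorph.symm_apply_apply (stoneCechHomeomorphUltrafilter D) p.1, h]
  exact (ultrafilter_extend_pure _ a).symm

theorem isClopen_star (A : Set D) : IsClopen (star A) :=
  IsClopen.preimage ⟨ultrafilter_isClosed_basic A, ultrafilter_isOpen_basic A⟩
    ((stoneCechHomeomorphUltrafilter D).continuous.comp continuous_subtype_val)

theorem isRegularClosed_star (A : Set D) : IsRegularClosed (star A) := by
  rw [IsRegularClosed, (isClopen_star A).isOpen.interior_eq, (isClopen_star A).isClosed.closure_eq]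

theorem star_mono {A B : Set D} (h : A ⊆ B) : star A ⊆ star B :=
  fun _ hp => mem_of_superset hp h

theorem disjoint_star {A B : Set D} (h : Disjoint A B) : Disjoint (star A) (star B) := by
  rw [disjoint_left]
  intro p hA hB
  refine (stoneCechHomeomorphUltrafilter D p.1).empty_notMem ?_
  rw [← h.inter_eq]
  exact inter_mem hA hB

theorem star_nonempty {A : Set D} (hA : A.Infinite) : (star A).Nonempty := by
  have := hA.cofinite_inf_principal_neBot
  let v := Ultrafilter.of (cofinite ⊓ 𝓟 A)
  have hv : (v : Filter D) ≤ cofinite ⊓ 𝓟 A := Ultrafilter.of_le _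
  refine ⟨⟨(stoneCechHomeomorphUltrafilter D).symm v, ?_⟩, ?_⟩
  · rintro ⟨a, ha⟩
    have h : v = pure a := by
      rw [← Homeomorph.apply_symm_apply (stoneCechHomeomorphUltrafilter D) v, ← ha]
      exact stoneCechExtend_stoneCechUnit continuous_of_discreteTopology a
    have hmem : {a}ᶜ ∈ v := hv.trans inf_le_left (finite_singleton a).compl_mem_cofinite
    rw [h] at hmem
    exact hmem rfl
  · change A ∈ stoneCechHomeomorphUltrafilter D ((stoneCechHomeomorphUltrafilter D).symm v)
    rw [Homeomorph.apply_symm_apply]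
    exact hv.trans inf_le_right (mem_principal_self A)

theorem exists_star_subset {O : Set (StoneCechRemainder D)} (hO : IsOpen O) (hne : O.Nonempty) :
    ∃ f : ℕ → D, (range f).Infinite ∧ star (range f) ⊆ O := by
  obtain ⟨p, hp⟩ := hne
  have hind : IsInducing fun q : StoneCechRemainder D => stoneCechHomeomorphUltrafilter D q.1 :=
    (stoneCechHomeomorphUltrafilter D).isInducing.comp IsInducing.subtypeVal
  obtain ⟨_, ⟨_, ⟨A, rfl⟩, rfl⟩, hpA, hAO⟩ :=
    (ultrafilterBasis_is_basis.isInducing hind).exists_subset_of_mem_open hp hO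
  have hA : A.Infinite := infinite_of_mem_of_ne_pure hpA (homeomorph_ne_pure p)
  let f := hA.natEmbedding A
  refine ⟨fun n => f n, infinite_range_of_injective
    (Subtype.val_injective.comp f.injective), Subset.trans (star_mono ?_) hAO⟩
  rintro _ ⟨n, rfl⟩
  exact (f n).2

theorem exists_basic_star_subset {U : Set (Theta (StoneCechRemainder D))} (hU : IsOpen U)
    (hne : U.Nonempty) :
    ∃ f : ℕ → D, (range f).Infinite ∧ Theta.basic (star (range f)) ⊆ U := by
  obtain ⟨F, hF⟩ := hne
  obtain ⟨_, ⟨A, hA, rfl⟩, hAF, hAU⟩ :=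
    (Theta.isTopologicalBasis_basic _).exists_subset_of_mem_open hF hU
  have hint : (interior A).Nonempty := by
    rw [← closure_nonempty_iff, hA, nonempty_iff_ne_empty]
    rintro rfl
    exact F.2.prop.empty_notMem hAF
  obtain ⟨f, hf, hfA⟩ := exists_star_subset isOpen_interior hint
  exact ⟨f, hf, (Theta.basic_mono hA (hfA.trans interior_subset)).trans hAU⟩

theorem disjoint_basic_star {A B : Set D} (h : Disjoint A B) :
    Disjoint (Theta.basic (star A)) (Theta.basic (star B)) := by
  rw [Theta.disjoint_basic_iff (isRegularClosed_star A) (isRegularClosed_star B),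
    (disjoint_star h).inter_eq, interior_empty]

theorem basic_star_nonempty {A : Set D} (hA : A.Infinite) : (Theta.basic (star A)).Nonempty :=
  Theta.basic_nonempty (isRegularClosed_star A) (star_nonempty hA)

/-- An isolated point would lie in the disjoint basic sets given by two halves of one countable set.
-/
theorem infinite_of_isOpen {U : Set (Theta (StoneCechRemainder D))} (hU : IsOpen U)
    (hne : U.Nonempty) : U.Infinite := by
  have key : ∀ x : Theta (StoneCechRemainder D), ¬ IsOpen {x} := fun x hx => by
    obtain ⟨f, hf, hfx⟩ := exists_basic_star_subset hx (singleton_nonempty x)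
    obtain ⟨g, hg⟩ : ∃ g : ℕ → D, Function.Injective g ∧ range g ⊆ range f :=
      ⟨fun n => hf.natEmbedding _ n, Subtype.val_injective.comp (hf.natEmbedding _).injective,
        by rintro _ ⟨n, rfl⟩; exact (hf.natEmbedding _ n).2⟩
    have hmem : ∀ h : ℕ → ℕ, Function.Injective h → x ∈ Theta.basic (star (range (g ∘ h))) :=
      fun h hh => by
        obtain ⟨y, hy⟩ := basic_star_nonempty (infinite_range_of_injective (hg.1.comp hh))
        have hyx : y ∈ ({x} : Set _) := hfx (Theta.basic_mono (isRegularClosed_star _)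
          (star_mono ((range_comp_subset_range h g).trans hg.2)) hy)
        rwa [← mem_singleton_iff.1 hyx]
    refine disjoint_left.1 (disjoint_basic_star ?_)
      (hmem (fun n => 2 * n) fun a b h => by dsimp only at h; omega)
      (hmem (fun n => 2 * n + 1) fun a b h => by dsimp only at h; omega)
    rw [disjoint_left]
    rintro _ ⟨m, rfl⟩ ⟨n, hn⟩
    have := hg.1 hn
    dsimp only at this
    omega
  obtain ⟨x, hx⟩ := hne
  have : (𝓝[≠] x).NeBot := ⟨fun h => key x ((isOpen_singleton_iff_punctured_nhds x).2 h)⟩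
  exact infinite_of_mem_nhds x (hU.mem_nhds hx)

variable (D) in
theorem exists_pairwise_disjoint_isOpen [Infinite D] :
    ∃ U : D → Set (Theta (StoneCechRemainder D)), (∀ d, IsOpen (U d)) ∧ (∀ d, (U d).Nonempty) ∧
      Pairwise fun d e => Disjoint (U d) (U e) := by
  -- The fibres over the first coordinate partition `D` into `#D` countably infinite pieces.
  obtain ⟨e⟩ : Nonempty (D × ℕ ≃ D) := by
    refine Cardinal.eq.1 ?_ |>.map fun e => e
    rw [mk_prod, lift_uzero, mk_nat, lift_aleph0, mul_aleph0_eq (aleph0_le_mk D)]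
  refine ⟨fun d => Theta.basic (star (range fun n => e (d, n))),
    fun d => Theta.isOpen_basic (isRegularClosed_star _),
    fun d => basic_star_nonempty (infinite_range_of_injective fun m n h => ?_),
    fun d d' hd => disjoint_basic_star ?_⟩
  · simpa using h
  · rw [disjoint_left]
    rintro _ ⟨m, rfl⟩ ⟨n, hn⟩
    exact hd (congrArg Prod.fst (e.injective hn)).symm

variable (D) in
theorem mk_le_density [Infinite D] : #D ≤ density (Theta (StoneCechRemainder D)) := by
  obtain ⟨U, hU, hne, hdisj⟩ := exists_pairwise_disjoint_isOpen D
  refine le_max_of_le_right (le_csInf ⟨_, univ, dense_univ, rfl⟩ ?_)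
  rintro _ ⟨S, hS, rfl⟩
  choose x hxU hxS using fun d => hS.inter_open_nonempty (U d) (hU d) (hne d)
  refine mk_le_of_injective (f := fun d => (⟨x d, hxS d⟩ : S)) fun d d' h => ?_
  by_contra hd
  have hx : x d = x d' := congrArg Subtype.val h
  exact disjoint_left.1 (hdisj hd) (hxU d) (hx ▸ hxU d')

variable (D) in
theorem mk_le_weight [Infinite D] : #D ≤ weight (Theta (StoneCechRemainder D)) := by
  obtain ⟨U, hU, hne, hdisj⟩ := exists_pairwise_disjoint_isOpen D
  refine le_max_of_le_right
    (le_csInf ⟨_, _, TopologicalSpace.isTopologicalBasis_opens, rfl⟩ ?_)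
  rintro _ ⟨B, hB, rfl⟩
  choose x hx using hne
  choose V hVB hxV hVU using fun d => hB.exists_subset_of_mem_open (hx d) (hU d)
  refine mk_le_of_injective (f := fun d => (⟨V d, hVB d⟩ : B)) fun d d' h => ?_
  by_contra hd
  have hV : V d = V d' := congrArg Subtype.val h
  exact disjoint_left.1 (hdisj hd) (hVU d (hxV d)) (hVU d' (hV ▸ hxV d))

variable (D) in
theorem density_le [Infinite D] : density (Theta (StoneCechRemainder D)) ≤ #(ℕ → D) := by
  have hne : ∀ f : {f : ℕ → D // (range f).Infinite}, (Theta.basic (star (range f.1))).Nonempty :=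
    fun f => basic_star_nonempty f.2
  choose x hx using hne
  refine max_le (aleph0_le_mk _) (csInf_le_of_le (OrderBot.bddBelow _) ⟨range x, ?_, rfl⟩
    (mk_range_le.trans (mk_subtype_le _)))
  refine dense_iff_inter_open.2 fun U hU hUne => ?_
  obtain ⟨f, hf, hfU⟩ := exists_basic_star_subset hU hUne
  exact ⟨x ⟨f, hf⟩, hfU (hx _), mem_range_self _⟩

/-- Stars of countable sets form a π-base, so a regular closed set is determined by those it
contains; this injects the algebra into `Set (ℕ → D)`. -/
theorem closure_iUnion_star {A : Set (StoneCechRemainder D)} (hA : IsRegularClosed A) :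
    closure (⋃ f ∈ {f : ℕ → D | star (range f) ⊆ A}, star (range f)) = A := by
  refine subset_antisymm (closure_minimal (iUnion₂_subset fun f hf => hf) hA.isClosed) ?_
  rw [← hA]
  refine closure_minimal (fun p hp => mem_closure_iff.2 fun O hO hpO => ?_) isClosed_closure
  obtain ⟨f, hf, hfO⟩ := exists_star_subset (hO.inter isOpen_interior) ⟨p, hpO, hp⟩
  obtain ⟨q, hq⟩ := star_nonempty hf
  refine ⟨q, (hfO hq).1, mem_iUnion₂.2 ⟨f, ?_, hq⟩⟩
  change star (range f) ⊆ closure (interior A)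
  rw [hA]
  exact fun r hr => interior_subset (hfO hr).2

variable (D) in
theorem weight_le [Infinite D] :
    weight (Theta (StoneCechRemainder D)) ≤ (2 : Cardinal.{u}) ^ #(ℕ → D) := by
  refine max_le ((aleph0_le_mk (ℕ → D)).trans (cantor _).le) (csInf_le_of_le
    (OrderBot.bddBelow _) ⟨_, Theta.isTopologicalBasis_basic _, rfl⟩ ?_)
  let R := {A : Set (StoneCechRemainder D) // IsRegularClosed A}
  calc #{V : Set (Theta (StoneCechRemainder D)) | ∃ A, IsRegularClosed A ∧ V = Theta.basic A}
      ≤ #R := by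
        refine mk_le_of_surjective
          (f := fun A : R => ⟨Theta.basic A.1, A.1, A.2, rfl⟩) ?_
        rintro ⟨_, A, hA, rfl⟩
        exact ⟨⟨A, hA⟩, rfl⟩
    _ ≤ #(Set (ℕ → D)) := by
        refine mk_le_of_injective
          (f := fun A : R => {f : ℕ → D | star (range f) ⊆ A.1}) fun A B h => Subtype.ext ?_
        dsimp only at h
        rw [← closure_iUnion_star A.2, ← closure_iUnion_star B.2, h]
    _ = 2 ^ #(ℕ → D) := mk_set

end StoneCechRemainder

end SHDSpace

/-- For every infinite cardinal `κ`, the space `θ(D^*)`, where `D` is the discrete space of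
cardinality `2^κ`, has all the required properties. -/
theorem mainTheorem7 (κ : Cardinal.{u}) (hκ : ℵ₀ ≤ κ)
    (D : Type u) [TopologicalSpace D] [DiscreteTopology D] (hD : #D = (2 : Cardinal.{u}) ^ κ) :
    CompactSpace (SHDSpace.Theta (SHDSpace.StoneCechRemainder D)) ∧
    T2Space (SHDSpace.Theta (SHDSpace.StoneCechRemainder D)) ∧
    SHDSpace.IsZeroDimensional (SHDSpace.Theta (SHDSpace.StoneCechRemainder D)) ∧
    SHDSpace.IsSHD (SHDSpace.Theta (SHDSpace.StoneCechRemainder D)) ∧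
    SHDSpace.density (SHDSpace.Theta (SHDSpace.StoneCechRemainder D)) = (2 : Cardinal.{u}) ^ κ ∧
    (2 : Cardinal.{u}) ^ κ ≤ SHDSpace.weight (SHDSpace.Theta (SHDSpace.StoneCechRemainder D)) ∧
    SHDSpace.weight (SHDSpace.Theta (SHDSpace.StoneCechRemainder D)) ≤ (2 : Cardinal.{u}) ^ ((2 : Cardinal.{u}) ^ κ) := by
  have : Infinite D := by
    rw [infinite_iff, hD]
    exact hκ.trans (cantor κ).le
  have hseq : #(ℕ → D) = (2 : Cardinal.{u}) ^ κ := by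
    rw [mk_arrow, lift_uzero, mk_nat, lift_aleph0, hD, ← power_mul, mul_aleph0_eq hκ]
  refine ⟨inferInstance, inferInstance, SHDSpace.Theta.isZeroDimensional,
    SHDSpace.Theta.isSHD_of_infinite fun U => SHDSpace.StoneCechRemainder.infinite_of_isOpen,
    le_antisymm ?_ ?_, ?_, ?_⟩
  · exact hseq ▸ SHDSpace.StoneCechRemainder.density_le D
  · exact hD ▸ SHDSpace.StoneCechRemainder.mk_le_density D
  · exact hD ▸ SHDSpace.StoneCechRemainder.mk_le_weight D
  · exact hseq ▸ SHDSpace.StoneCechRemainder.weight_le D
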